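/- Let $n,m\ge 0$ be integers, let $\Omega\subseteq\mathbb{R}^n$ be compact, let $\mu$ be a probability measure on $\mathbb{R}^n$ that is concentrated on $\Omega$ and absolutely continuous with respect to Lebesgue measure on $\Omega$, let $\ell:\mathbb{R}^m\times\mathbb{R}^n\to\mathbb{R}$ be continuously differentiable, and let $\eta\ge 0$. For $S\subseteq\mathbb{R}^p$ write $C^\infty(S;\mathbb{R}^q)$ for the set of maps $\mathbb{R}^p\to\mathbb{R}^q$ that are infinitely differentiable on some open set containing $S$. Let $Jf[x]$ denote the Jacobian matrix of $f$ at $x$, $\|A\|_*$ the nuclear norm (the sum of the singular values) and $\|A\|_F$ the Frobenius norm of a matrix $A$. Then all the expectations below exist and are finite, and $$\inf_{f\in C^\infty(\Omega;\mathbb{R}^m)}\ \mathbb{E}_{x\sim\mu}\bigl[\ell(f(x),x)+\eta\,\|Jf[x]\|_*\bigr]\;=\;\inf_{\substack{d\in\mathbb{N},\ h\in C^\infty(\Omega;\mathbb{R}^d),\\ g\in C^\infty(h(\Omega);\mathbb{R}^m)}}\ \mathbb{E}_{x\sim\mu}\Bigl[\ell(g(h(x)),x)+\frac{\eta}{2}\bigl(\|Jg[h(x)]\|_F^2+\|Jh[x]\|_F^2\bigr)\Bigr],$$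 where the inner dimension $d$ is not fixed but ranges over all of $\mathbb{N}$, and the infima are taken in $[-\infty,\infty)$. -/

import Mathlib

open MeasureTheory
open scoped ContDiff

noncomputable section

/-- A map `f : ℝⁿ → ℝᵐ` is of class `C^∞` on an arbitrary set `S` of `ℝⁿ` if it is
infinitely differentiable on some open set that contains `S`. -/
def SmoothOn {n m : ℕ} (f : EuclideanSpace ℝ (Fin n) → EuclideanSpace ℝ (Fin m))
    (S : Set (EuclideanSpace ℝ (Fin n))) : Prop :=
  ∃ U : Set (EuclideanSpace ℝ (Fin n)), IsOpen U ∧ S ⊆ U ∧ ContDiffOn ℝ ∞ f U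

/-- The Jacobian matrix `Jf[x]`, whose `(i, j)` entry is `∂f_i/∂x_j (x)`. -/
def jacobian {n m : ℕ} (f : EuclideanSpace ℝ (Fin n) → EuclideanSpace ℝ (Fin m))
    (x : EuclideanSpace ℝ (Fin n)) : Matrix (Fin m) (Fin n) ℝ :=
  Matrix.of fun i j => (fderiv ℝ f x (EuclideanSpace.single j 1)) i

/-- The nuclear norm `‖A‖_*`: the sum of the singular values of `A`. -/
def nuclearNorm {m n : ℕ} (A : Matrix (Fin m) (Fin n) ℝ) : ℝ :=
  ∑ i ∈ Finset.range n, (Matrix.toEuclideanLin A).singularValues i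

/-- The squared Frobenius norm `‖A‖_F²`: the sum of the squares of the entries of `A`. -/
def frobeniusSq {m n : ℕ} (A : Matrix (Fin m) (Fin n) ℝ) : ℝ :=
  ∑ i, ∑ j, A i j ^ 2

/-- The integrand `ℓ(f(x), x) + η ‖Jf[x]‖_*`. -/
def nuclearIntegrand {n m : ℕ} (ℓ : EuclideanSpace ℝ (Fin m) × EuclideanSpace ℝ (Fin n) → ℝ)
    (η : ℝ) (f : EuclideanSpace ℝ (Fin n) → EuclideanSpace ℝ (Fin m))
    (x : EuclideanSpace ℝ (Fin n)) : ℝ :=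
  ℓ (f x, x) + η * nuclearNorm (jacobian f x)

/-- The integrand `ℓ(g(h(x)), x) + (η/2) (‖Jg[h(x)]‖_F² + ‖Jh[x]‖_F²)`. -/
def factoredIntegrand {n m d : ℕ}
    (ℓ : EuclideanSpace ℝ (Fin m) × EuclideanSpace ℝ (Fin n) → ℝ) (η : ℝ)
    (g : EuclideanSpace ℝ (Fin d) → EuclideanSpace ℝ (Fin m))
    (h : EuclideanSpace ℝ (Fin n) → EuclideanSpace ℝ (Fin d))
    (x : EuclideanSpace ℝ (Fin n)) : ℝ :=
  ℓ (g (h x), x) + η / 2 * (frobeniusSq (jacobian g (h x)) + frobeniusSq (jacobian h x))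

end

/-!
The two infima are compared through a pointwise statement about Jacobians.

A composition `f = g ∘ h` satisfies `Jf = Jg Jh`, and `2 ‖B C‖_* ≤ ‖B‖_F² + ‖C‖_F²` for all matrices
`B`, `C` (`two_mul_sum_singularValues_comp_le`), so every factored objective dominates the objective
of the composition.

Conversely, a smooth `f` is itself a composition `g ∘ h` with
`‖Jg[h(x)]‖_F² + ‖Jh[x]‖_F² ≤ 2 ‖Jf[x]‖_* + δ` on all of `Ω` (`SmoothOn.exists_factorization`). At a
single point this is a statement about the matrix `A = Jf[x]`: for right singular vectors `vᵢ` and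
weights `sᵢ > 0` with `sᵢ²` close to the singular values, the factorization of `A` through
`w ↦ (sᵢ ⟪vᵢ, w⟫)ᵢ` does it (`exists_weights`), and by continuity of the nuclear norm the same `vᵢ`
and `sᵢ` serve in a neighbourhood. What remains is to realize the first factors, which vary from
point to point, by the derivative of one map `h`. They need to be realized only up to an isometry of
the target, that is, `h` has to induce the metric `∑ sᵢ² vᵢ ⊗ vᵢ`, blended by a partition of unity
`∑ ψ² = 1` (`exists_sq_partition`). With the inner dimension `d` at our disposal, the twists of Nash do
so up to `O(ε²)`: the map `x ↦ ε s ψ(x) (cos (⟪v, x⟫ / ε), sin (⟪v, x⟫ / ε))` induces the metric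
`s² ψ² v ⊗ v + ε² s² dψ ⊗ dψ`, without cross terms, as the derivatives of radius and phase point in
orthogonal directions (`sum_norm_sq_twistDeriv`).

The encoder `h` consists of these twists, in independent planes, together with the coordinates `ε x`.
The latter make it injective, with the linear left inverse `p(y) = y₀ / ε`, so a decoder can be written
down without the inverse function theorem: `g(y) = f(p y) + L(p y) (y - h(p y))`. It satisfies
`g ∘ h = f`, and `Jg[h(x)] = L(x)` whenever `L(x) Jh[x] = Jf[x]` (`hasFDerivAt_twistDecoder`). The
matrix `L(x)` is chosen to vanish outside the directions in which the twists rotate; there it is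
`Jf[x]` composed with a left inverse of `Jh[x]`, and its Frobenius norm is that of the second factors
above, blended by the partition of unity (`sum_norm_sq_twistLift`).
-/

/-! ### Singular value decomposition and the nuclear norm -/

section SingularValues

open scoped RealInnerProductSpace

variable {n : ℕ} {E F : Type*} [NormedAddCommGroup E] [InnerProductSpace ℝ E]
  [NormedAddCommGroup F] [InnerProductSpace ℝ F]

/-- A family `u` of vectors satisfies Bessel's inequality. Orthonormal families do, and so do the
families obtained from them by replacing some members with `0`. -/
def IsBessel {ι : Type*} [Fintype ι] (u : ι → F) : Prop :=
  ∀ w, ∑ i, ⟪w, u i⟫ ^ 2 ≤ ‖w‖ ^ 2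

theorem IsBessel.norm_le_one {ι : Type*} [Fintype ι] {u : ι → F} (hu : IsBessel u) (i : ι) :
    ‖u i‖ ≤ 1 := by
  have h1 : ⟪u i, u i⟫ ^ 2 ≤ ‖u i‖ ^ 2 :=
    (Finset.single_le_sum (f := fun j => ⟪u i, u j⟫ ^ 2) (fun j _ => sq_nonneg _)
      (Finset.mem_univ i)).trans (hu (u i))
  rw [real_inner_self_eq_norm_sq] at h1
  by_contra! h
  have h2 : 1 < ‖u i‖ ^ 2 := one_lt_pow₀ h two_ne_zero
  nlinarith

variable [FiniteDimensional ℝ E] [FiniteDimensional ℝ F]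

/-- Singular value decomposition. The left singular vectors that belong to the singular value `0`
are taken to be `0`, so the family `u` is a Bessel family rather than an orthonormal one. -/
theorem exists_singular_vectors (T : E →ₗ[ℝ] F) (hn : Module.finrank ℝ E = n) :
    ∃ (v : OrthonormalBasis (Fin n) ℝ E) (u : Fin n → F), IsBessel u ∧
      (∀ i, T (v i) = T.singularValues i • u i) ∧
      ∀ i, ⟪T (v i), u i⟫ = T.singularValues i := by
  set S := T.isSymmetric_adjoint_comp_self
  set v := S.eigenvectorBasis hn
  set σ : Fin n → ℝ := fun i => T.singularValues i
  have hin : ∀ i j, ⟪T (v i), T (v j)⟫ = if i = j then σ i ^ 2 else 0 := by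
    intro i j
    have h1 : ⟪T (v i), T (v j)⟫ = ⟪(T.adjoint ∘ₗ T) (v i), v j⟫ := by
      simp [LinearMap.adjoint_inner_left]
    rw [h1, S.apply_eigenvectorBasis hn i, inner_smul_left,
      orthonormal_iff_ite.mp v.orthonormal i j, ← T.sq_singularValues_fin hn i]
    simp [σ]
  have hz : ∀ i, σ i = 0 → T (v i) = 0 := fun i hi => by
    have := hin i i
    rw [if_pos rfl, hi, real_inner_self_eq_norm_sq] at this
    simpa using this
  refine ⟨v, fun i => (σ i)⁻¹ • T (v i), fun w => ?_, fun i => ?_, fun i => ?_⟩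
  · have ho : Orthonormal ℝ (fun i : {i // σ i ≠ 0} => (σ i)⁻¹ • T (v i)) := by
      rw [orthonormal_iff_ite]
      rintro ⟨i, hi⟩ ⟨j, hj⟩
      simp only [inner_smul_left, inner_smul_right, hin, Subtype.mk.injEq]
      split_ifs with h
      · subst h
        simp; field_simp
      · simp
    have hb := ho.sum_inner_products_le (s := Finset.univ) (x := w)
    calc ∑ i, ⟪w, (σ i)⁻¹ • T (v i)⟫ ^ 2
        = ∑ i with σ i ≠ 0, ⟪w, (σ i)⁻¹ • T (v i)⟫ ^ 2 := by
          refine (Finset.sum_filter_of_ne fun i _ h => ?_).symm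
          contrapose! h
          simp [h]
      _ = ∑ i : {i // σ i ≠ 0}, ⟪w, (σ i)⁻¹ • T (v i)⟫ ^ 2 :=
          Finset.sum_subtype _ (by simp) _
      _ ≤ ‖w‖ ^ 2 := by
          refine le_trans (le_of_eq (Finset.sum_congr rfl fun i _ => ?_)) hb
          rw [real_inner_comm, Real.norm_eq_abs, sq_abs]
  · by_cases h : σ i = 0
    · simp [hz i h]
    · rw [smul_smul, mul_inv_cancel₀ h, one_smul]
  · rw [inner_smul_right, hin, if_pos rfl]
    change (σ i)⁻¹ * σ i ^ 2 = σ i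
    by_cases h : σ i = 0
    · simp [h]
    · field_simp

/-- The nuclear norm is the maximum of the traces `∑ ⟪T vᵢ, uᵢ⟫`; this is the upper bound. -/
theorem sum_inner_le_sum_singularValues (T : E →ₗ[ℝ] F) (v : OrthonormalBasis (Fin n) ℝ E)
    {u : Fin n → F} (hu : IsBessel u) :
    ∑ i, ⟪T (v i), u i⟫ ≤ ∑ i : Fin n, T.singularValues i := by
  have hn : Module.finrank ℝ E = n := by simpa using Module.finrank_eq_card_basis v.toBasis
  obtain ⟨v', u', hu', hT, -⟩ := exists_singular_vectors T hn
  have key : ∀ i, ⟪T (v i), u i⟫ = ∑ k : Fin n, T.singularValues k * (⟪v' k, v i⟫ * ⟪u' k, u i⟫) := by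
    intro i
    conv_lhs => rw [← v'.sum_repr' (v i)]
    simp only [map_sum, map_smul, sum_inner, hT, inner_smul_left, conj_trivial]
    exact Finset.sum_congr rfl fun k _ => by ring
  simp only [key]
  rw [Finset.sum_comm]
  refine Finset.sum_le_sum fun k _ => ?_
  rw [← Finset.mul_sum]
  refine mul_le_of_le_one_right (T.singularValues_nonneg _) ?_
  have h1 : ∑ i, ⟪v' k, v i⟫ ^ 2 = 1 := by
    have := v.sum_sq_norm_inner_left (v' k)
    simpa using this
  have h2 := hu (u' k)
  have h3 := hu'.norm_le_one k
  have h4 : ∑ i, ⟪v' k, v i⟫ * ⟪u' k, u i⟫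
      ≤ ∑ i, (⟪v' k, v i⟫ ^ 2 + ⟪u' k, u i⟫ ^ 2) / 2 :=
    Finset.sum_le_sum fun i _ => by nlinarith [sq_nonneg (⟪v' k, v i⟫ - ⟪u' k, u i⟫)]
  rw [← Finset.sum_div, Finset.sum_add_distrib, h1] at h4
  nlinarith [norm_nonneg (u' k)]

theorem sum_norm_sq_apply_eq_sum_adjoint {ι κ : Type*} [Fintype ι] [Fintype κ] (T : E →ₗ[ℝ] F)
    (b : OrthonormalBasis ι ℝ E) (c : OrthonormalBasis κ ℝ F) :
    ∑ i, ‖T (b i)‖ ^ 2 = ∑ k, ‖T.adjoint (c k)‖ ^ 2 := by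
  have h1 : ∀ i, ‖T (b i)‖ ^ 2 = ∑ k, ‖⟪T (b i), c k⟫‖ ^ 2 := fun i =>
    (c.sum_sq_norm_inner_left _).symm
  have h2 : ∀ k, ‖T.adjoint (c k)‖ ^ 2 = ∑ i, ‖⟪T (b i), c k⟫‖ ^ 2 := fun k => by
    simp only [← b.sum_sq_norm_inner_right (T.adjoint _), LinearMap.adjoint_inner_right]
  simp only [h1, h2]
  exact Finset.sum_comm

/-- The Hilbert-Schmidt norm can be computed in any orthonormal basis. -/
theorem sum_norm_sq_apply_eq {ι κ : Type*} [Fintype ι] [Fintype κ] (T : E →ₗ[ℝ] F)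
    (b : OrthonormalBasis ι ℝ E) (c : OrthonormalBasis κ ℝ E) :
    ∑ i, ‖T (b i)‖ ^ 2 = ∑ k, ‖T (c k)‖ ^ 2 := by
  rw [sum_norm_sq_apply_eq_sum_adjoint T b (stdOrthonormalBasis ℝ F),
    sum_norm_sq_apply_eq_sum_adjoint T c (stdOrthonormalBasis ℝ F)]

theorem sum_norm_sq_adjoint_le {ι κ : Type*} [Fintype ι] [Fintype κ] (T : E →ₗ[ℝ] F)
    (b : OrthonormalBasis ι ℝ E) {u : κ → F} (hu : IsBessel u) :
    ∑ k, ‖T.adjoint (u k)‖ ^ 2 ≤ ∑ i, ‖T (b i)‖ ^ 2 := by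
  simp only [← b.sum_sq_norm_inner_right (T.adjoint _), LinearMap.adjoint_inner_right]
  rw [Finset.sum_comm]
  refine Finset.sum_le_sum fun i _ => ?_
  simpa using hu (T (b i))

/-- For a product, the arithmetic-geometric mean inequality bounds the nuclear norm by the two
Hilbert-Schmidt norms. -/
theorem two_mul_sum_singularValues_comp_le {κ G : Type*} [Fintype κ] [NormedAddCommGroup G]
    [InnerProductSpace ℝ G] [FiniteDimensional ℝ G] (B : G →ₗ[ℝ] F) (C : E →ₗ[ℝ] G)
    (e : OrthonormalBasis (Fin n) ℝ E) (b : OrthonormalBasis κ ℝ G) :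
    2 * ∑ i : Fin n, (B ∘ₗ C).singularValues i ≤ ∑ k, ‖B (b k)‖ ^ 2 + ∑ i, ‖C (e i)‖ ^ 2 := by
  have hn : Module.finrank ℝ E = n := by simpa using Module.finrank_eq_card_basis e.toBasis
  obtain ⟨v, u, hu, -, hT⟩ := exists_singular_vectors (B ∘ₗ C) hn
  rw [sum_norm_sq_apply_eq C e v, Finset.mul_sum]
  refine le_trans ?_ (add_le_add_left (sum_norm_sq_adjoint_le B b hu) _)
  rw [← Finset.sum_add_distrib]
  refine Finset.sum_le_sum fun i _ => ?_
  rw [← hT i, LinearMap.comp_apply, ← LinearMap.adjoint_inner_right]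
  have := real_inner_le_norm (C (v i)) (B.adjoint (u i))
  nlinarith [sq_nonneg (‖C (v i)‖ - ‖B.adjoint (u i)‖)]

/-- The nuclear norm is Lipschitz with respect to the operator norm. -/
theorem sum_singularValues_le_add (e : OrthonormalBasis (Fin n) ℝ E) (S T : E →L[ℝ] F) :
    ∑ i : Fin n, (S : E →ₗ[ℝ] F).singularValues i ≤
      ∑ i : Fin n, (T : E →ₗ[ℝ] F).singularValues i + n * ‖S - T‖ := by
  have hn : Module.finrank ℝ E = n := by simpa using Module.finrank_eq_card_basis e.toBasis
  obtain ⟨v, u, hu, -, hS⟩ := exists_singular_vectors (S : E →ₗ[ℝ] F) hn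
  have h1 := sum_inner_le_sum_singularValues (T : E →ₗ[ℝ] F) v hu
  have h2 : ∑ i, ⟪(S - T) (v i), u i⟫ ≤ ∑ _i : Fin n, ‖S - T‖ := by
    refine Finset.sum_le_sum fun i _ => (real_inner_le_norm _ _).trans ?_
    have := (S - T).le_opNorm (v i)
    rw [v.norm_eq_one, mul_one] at this
    exact (mul_le_of_le_one_right (norm_nonneg _) (hu.norm_le_one i)).trans this
  simp only [← hS]
  simp only [ContinuousLinearMap.coe_coe, sub_apply, inner_sub_left,
    Finset.sum_sub_distrib, Finset.sum_const, Finset.card_univ, Fintype.card_fin,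
    nsmul_eq_mul] at h1 h2 ⊢
  linarith

theorem continuous_sum_singularValues (e : OrthonormalBasis (Fin n) ℝ E) :
    Continuous fun T : E →L[ℝ] F => ∑ i : Fin n, (T : E →ₗ[ℝ] F).singularValues i := by
  refine (LipschitzWith.of_le_add_mul (n : NNReal) fun S T => ?_).continuous
  simpa [dist_eq_norm] using sum_singularValues_le_add e S T

/-- The bound of `two_mul_sum_singularValues_comp_le` is nearly attained by the factorization of
`T` through `x ↦ (sᵢ ⟪vᵢ, x⟫)ᵢ`, where `v` consists of right singular vectors and `sᵢ` is the square
root of the `i`-th singular value, moved away from `0` to be invertible. -/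
theorem exists_weights (e : OrthonormalBasis (Fin n) ℝ E) (T : E →ₗ[ℝ] F) {δ : ℝ} (hδ : 0 < δ) :
    ∃ (v : OrthonormalBasis (Fin n) ℝ E) (s : Fin n → ℝ), (∀ i, 0 < s i) ∧
      ∑ i, (s i ^ 2 + (s i)⁻¹ ^ 2 * ‖T (v i)‖ ^ 2) ≤
        2 * ∑ i : Fin n, T.singularValues i + n * δ := by
  have hn : Module.finrank ℝ E = n := by simpa using Module.finrank_eq_card_basis e.toBasis
  obtain ⟨v, u, hu, hT, -⟩ := exists_singular_vectors T hn
  have hpos : ∀ i : Fin n, 0 < T.singularValues i + δ := fun i =>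
    add_pos_of_nonneg_of_pos (T.singularValues_nonneg _) hδ
  refine ⟨v, fun i => √(T.singularValues i + δ), fun i => Real.sqrt_pos.mpr (hpos i), ?_⟩
  have hc : (n : ℝ) * δ = ∑ _i : Fin n, δ := by simp
  rw [hc, Finset.mul_sum, ← Finset.sum_add_distrib]
  refine Finset.sum_le_sum fun i _ => ?_
  have h0 := T.singularValues_nonneg i
  have h1 := hu.norm_le_one i
  have h2 := hpos i
  rw [inv_pow, Real.sq_sqrt h2.le, hT, norm_smul, Real.norm_of_nonneg h0]
  have h3 : (T.singularValues i + δ)⁻¹ * (T.singularValues i * ‖u i‖) ^ 2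
      ≤ T.singularValues i := by
    rw [inv_mul_le_iff₀ h2]
    have h5 : ‖u i‖ ^ 2 ≤ 1 := pow_le_one₀ (norm_nonneg _) h1
    have h6 : (T.singularValues i * ‖u i‖) ^ 2 ≤ T.singularValues i ^ 2 := by
      rw [mul_pow]
      exact mul_le_of_le_one_right (sq_nonneg _) h5
    nlinarith [mul_nonneg hδ.le h0]
  linarith

end SingularValues

/-! ### Nash twists -/

section NashTwist

open scoped RealInnerProductSpace

variable {ι K E F G : Type*}
  [NormedAddCommGroup E] [InnerProductSpace ℝ E]
  [NormedAddCommGroup F] [InnerProductSpace ℝ F] [NormedAddCommGroup G] [InnerProductSpace ℝ G]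

/-- The family obtained from the orthonormal basis `b` by rotating, for each `k`, the plane spanned
by `b (inr (inl k))` and `b (inr (inr k))` by the angle `θ k`. -/
noncomputable def rotated (b : ι ⊕ (K ⊕ K) → G) (θ : K → ℝ) : ι ⊕ (K ⊕ K) → G :=
  Sum.elim (fun j => b (.inl j)) (Sum.elim
    (fun k => Real.cos (θ k) • b (.inr (.inl k)) + Real.sin (θ k) • b (.inr (.inr k)))
    (fun k => -Real.sin (θ k) • b (.inr (.inl k)) + Real.cos (θ k) • b (.inr (.inr k))))

theorem orthonormal_rotated {b : ι ⊕ (K ⊕ K) → G} (hb : Orthonormal ℝ b) (θ : K → ℝ) :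
    Orthonormal ℝ (rotated b θ) := by
  classical
  rw [orthonormal_iff_ite] at hb ⊢
  rintro (i | i | i) (j | j | j) <;>
  simp only [rotated, Sum.elim_inl, Sum.elim_inr, inner_add_left, inner_add_right,
    real_inner_smul_left, real_inner_smul_right, hb, Sum.inl.injEq, Sum.inr.injEq, reduceCtorEq,
    if_false, mul_zero, add_zero, zero_add]
  all_goals
    split_ifs with h
    · subst h
      linarith [Real.sin_sq_add_cos_sq (θ i)]
    · ring

variable [Fintype ι] [Fintype K]

/-- `rotated` as an orthonormal basis. -/
noncomputable def rotatedBasis (b : OrthonormalBasis (ι ⊕ (K ⊕ K)) ℝ G) (θ : K → ℝ) :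
    OrthonormalBasis (ι ⊕ (K ⊕ K)) ℝ G :=
  have : FiniteDimensional ℝ G := b.toBasis.finiteDimensional_of_finite
  have ho := orthonormal_rotated b.orthonormal θ
  (basisOfLinearIndependentOfCardEqFinrank' _ ho.linearIndependent
    (Module.finrank_eq_card_basis b.toBasis).symm).toOrthonormalBasis (by simpa using ho)

theorem coe_rotatedBasis (b : OrthonormalBasis (ι ⊕ (K ⊕ K)) ℝ G) (θ : K → ℝ) :
    ⇑(rotatedBasis b θ) = rotated b θ := by
  simp [rotatedBasis]

theorem OrthonormalBasis.norm_sq_sum_smul {κ : Type*} [Fintype κ] (b : OrthonormalBasis κ ℝ G)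
    (c : κ → ℝ) : ‖∑ i, c i • b i‖ ^ 2 = ∑ i, c i ^ 2 := by
  rw [← b.sum_sq_norm_inner_right]
  refine Finset.sum_congr rfl fun i _ => ?_
  rw [b.orthonormal.inner_right_fintype, Real.norm_eq_abs, sq_abs]

variable (b : OrthonormalBasis (ι ⊕ (K ⊕ K)) ℝ G) (e : OrthonormalBasis ι ℝ E)
  (ε : ℝ) (a : K → E → ℝ) (s : K → ℝ) (ℓ : K → E)

/-- The phases of the Nash twists. -/
noncomputable def twistPhase (x : E) (k : K) : ℝ := ε⁻¹ * ⟪ℓ k, x⟫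

/-- The encoder: a small multiple of the isometry `e j ↦ b (inl j)`, to which for each `k` a fast
rotation of small radius `ε sₖ aₖ(x)` in the direction `ℓ k` is added. As `ε → 0`, the metric that
it induces on `E` tends to `∑ sₖ² aₖ² ℓₖ ⊗ ℓₖ`. -/
noncomputable def twistMap (x : E) : G :=
  ∑ j, (ε * ⟪e j, x⟫) • rotated b (twistPhase ε ℓ x) (.inl j) +
    ∑ k, (ε * (s k * a k x)) • rotated b (twistPhase ε ℓ x) (.inr (.inl k))

/-- A linear left inverse of the encoder `twistMap`. -/
noncomputable def twistProj : G →L[ℝ] E :=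
  ε⁻¹ • ∑ j, (innerSL ℝ (b (.inl j))).smulRight (e j)

/-- The derivative of the encoder `twistMap`, where `a' k` is the derivative of `a k` at `x`. -/
noncomputable def twistDeriv (a' : K → E →L[ℝ] ℝ) (x : E) : E →L[ℝ] G :=
  ∑ j, (ε • innerSL ℝ (e j)).smulRight (rotated b (twistPhase ε ℓ x) (.inl j)) +
    ∑ k, ((s k * a k x) • innerSL ℝ (ℓ k)).smulRight
        (rotated b (twistPhase ε ℓ x) (.inr (.inr k))) +
    ∑ k, ((ε * s k) • a' k).smulRight (rotated b (twistPhase ε ℓ x) (.inr (.inl k)))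

/-- The linear part of the decoder at the image of `x`. If `∑ aₖ(x)² ℓₖ ⊗ ℓₖ` is the identity, then
it is `A` composed with a left inverse of the derivative of the encoder. -/
noncomputable def twistLift (A : E →L[ℝ] F) (x : E) : G →L[ℝ] F :=
  ∑ k, ((s k)⁻¹ * a k x) •
    (innerSL ℝ (rotated b (twistPhase ε ℓ x) (.inr (.inr k)))).smulRight (A (ℓ k))

/-- The decoder: it reproduces `f` on the image of the encoder, and is affine, with linear part
`twistLift`, on the fibres of `twistProj`. -/
noncomputable def twistDecoder (f : E → F) (y : G) : F :=
  f (twistProj b e ε y) +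
    twistLift b ε a s ℓ (fderiv ℝ f (twistProj b e ε y)) (twistProj b e ε y)
      (y - twistMap b e ε a s ℓ (twistProj b e ε y))

variable {b e ε a s ℓ}

theorem twistProj_twistMap (hε : ε ≠ 0) (x : E) :
    twistProj b e ε (twistMap b e ε a s ℓ x) = x := by
  classical
  have hb := orthonormal_iff_ite.mp (orthonormal_rotated b.orthonormal (twistPhase ε ℓ x))
  have h : ∀ j, ⟪b (.inl j), twistMap b e ε a s ℓ x⟫ = ε * ⟪e j, x⟫ := fun j => by
    change ⟪rotated b (twistPhase ε ℓ x) (.inl j), _⟫ = _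
    simp [twistMap, inner_add_right, inner_sum, real_inner_smul_right, hb]
  simp only [twistProj, smul_apply, sum_apply,
    ContinuousLinearMap.smulRight_apply, innerSL_apply_apply, h, Finset.smul_sum, smul_smul,
    inv_mul_cancel_left₀ hε, e.sum_repr']

theorem twistDecoder_twistMap (hε : ε ≠ 0) (f : E → F) (x : E) :
    twistDecoder b e ε a s ℓ f (twistMap b e ε a s ℓ x) = f x := by
  simp [twistDecoder, twistProj_twistMap hε]

theorem hasFDerivAt_twistMap (hε : ε ≠ 0) {a' : K → E →L[ℝ] ℝ} {x : E}
    (ha : ∀ k, HasFDerivAt (a k) (a' k) x) :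
    HasFDerivAt (twistMap b e ε a s ℓ) (twistDeriv b e ε a s ℓ a' x) x := by
  have hθ : ∀ k, HasFDerivAt (fun x => twistPhase ε ℓ x k) (ε⁻¹ • innerSL ℝ (ℓ k)) x := fun k =>
    (innerSL ℝ (ℓ k)).hasFDerivAt.const_mul ε⁻¹
  have h1 : ∀ j, HasFDerivAt (fun x => (ε * ⟪e j, x⟫) • b (.inl j))
      ((ε • innerSL ℝ (e j)).smulRight (b (.inl j))) x := fun j =>
    ((innerSL ℝ (e j)).hasFDerivAt.const_mul ε).smul_const _
  have h2 := fun k => (((ha k).const_mul (s k)).const_mul ε).smul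
    (((hθ k).cos.smul_const (b (.inr (.inl k)))).add ((hθ k).sin.smul_const (b (.inr (.inr k)))))
  have h3 := (HasFDerivAt.fun_sum (u := Finset.univ) fun j _ => h1 j).add
    (HasFDerivAt.fun_sum (u := Finset.univ) fun k _ => h2 k)
  refine h3.congr_fderiv ?_
  ext v
  simp only [twistDeriv, rotated, add_apply, sum_apply,
    add_assoc, ← Finset.sum_add_distrib, ContinuousLinearMap.smulRight_apply,
    smul_apply, Sum.elim_inl, Sum.elim_inr, innerSL_apply_apply,
    smul_eq_mul, Pi.add_apply]
  congr 1
  refine Finset.sum_congr rfl fun k _ => ?_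
  have : ∀ c t : ℝ, ε * (s k * a k x) * (c * (ε⁻¹ * t)) = s k * a k x * c * t := fun c t => by
    field_simp
  simp only [smul_add, smul_smul, this]
  module

theorem sum_norm_sq_twistDeriv [FiniteDimensional ℝ E] (hℓ : ∀ k, ‖ℓ k‖ = 1)
    (a' : K → E →L[ℝ] ℝ) (x : E) :
    ∑ i, ‖twistDeriv b e ε a s ℓ a' x (e i)‖ ^ 2 =
      ∑ k, s k ^ 2 * a k x ^ 2 +
        ε ^ 2 * (Fintype.card ι + ∑ k, s k ^ 2 * ∑ i, a' k (e i) ^ 2) := by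
  have h1 : ∀ v, twistDeriv b e ε a s ℓ a' x v =
      ∑ κ, (Sum.elim (fun j => ε * ⟪e j, v⟫) (Sum.elim (fun k => ε * s k * a' k v)
        (fun k => s k * a k x * ⟪ℓ k, v⟫)) κ) • rotatedBasis b (twistPhase ε ℓ x) κ := fun v => by
    simp [twistDeriv, coe_rotatedBasis, add_assoc, add_comm]
  have hnorm : ∀ v, ‖twistDeriv b e ε a s ℓ a' x v‖ ^ 2 = ∑ j, (ε * ⟪e j, v⟫) ^ 2 +
      (∑ k, (ε * s k * a' k v) ^ 2 + ∑ k, (s k * a k x * ⟪ℓ k, v⟫) ^ 2) := fun v => by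
    rw [h1, OrthonormalBasis.norm_sq_sum_smul]
    simp only [Fintype.sum_sum_type, Sum.elim_inl, Sum.elim_inr]
  simp only [hnorm, Finset.sum_add_distrib]
  have h2 : ∀ v, ∑ i, ⟪v, e i⟫ ^ 2 = ‖v‖ ^ 2 := fun v => by
    simpa using e.sum_sq_norm_inner_left v
  classical
  have h3 : ∑ i, ∑ j, (ε * ⟪e j, e i⟫) ^ 2 = ε ^ 2 * Fintype.card ι := by
    simp only [orthonormal_iff_ite.mp e.orthonormal]
    simp [mul_comm]
  have h4 : ∑ i, ∑ k, (s k * a k x * ⟪ℓ k, e i⟫) ^ 2 = ∑ k, s k ^ 2 * a k x ^ 2 := by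
    rw [Finset.sum_comm]
    simp [mul_pow, ← Finset.mul_sum, h2, hℓ]
  rw [h3, h4, Finset.sum_comm (f := fun i k => (ε * s k * a' k (e i)) ^ 2)]
  simp only [mul_pow, ← Finset.mul_sum, mul_assoc]
  ring

theorem twistLift_comp_twistDeriv (hs : ∀ k, s k ≠ 0) (A : E →L[ℝ] F) {x : E}
    (ha : ∀ v, ∑ k, (a k x ^ 2 * ⟪ℓ k, v⟫) • ℓ k = v) (a' : K → E →L[ℝ] ℝ) :
    twistLift b ε a s ℓ A x ∘L twistDeriv b e ε a s ℓ a' x = A := by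
  ext v
  classical
  have hb := orthonormal_iff_ite.mp (orthonormal_rotated b.orthonormal (twistPhase ε ℓ x))
  have h : ∀ k, ⟪rotated b (twistPhase ε ℓ x) (.inr (.inr k)), twistDeriv b e ε a s ℓ a' x v⟫ =
      s k * a k x * ⟪ℓ k, v⟫ := fun k => by
    simp [twistDeriv, inner_add_right, inner_sum, real_inner_smul_right, hb]
  conv_rhs => rw [← ha v, map_sum]
  simp only [twistLift, ContinuousLinearMap.comp_apply, smul_apply,
    sum_apply, ContinuousLinearMap.smulRight_apply, innerSL_apply_apply, h,
    smul_smul, map_smul]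
  refine Finset.sum_congr rfl fun k _ => ?_
  congr 1
  have := hs k
  field_simp

theorem sum_norm_sq_twistLift [FiniteDimensional ℝ F] (A : E →L[ℝ] F) (x : E) :
    ∑ κ, ‖twistLift b ε a s ℓ A x (b κ)‖ ^ 2 = ∑ k, (s k)⁻¹ ^ 2 * a k x ^ 2 * ‖A (ℓ k)‖ ^ 2 := by
  have : FiniteDimensional ℝ G := b.toBasis.finiteDimensional_of_finite
  classical
  have hb := orthonormal_iff_ite.mp (orthonormal_rotated b.orthonormal (twistPhase ε ℓ x))
  have h := sum_norm_sq_apply_eq (twistLift b ε a s ℓ A x : G →ₗ[ℝ] F) b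
    (rotatedBasis b (twistPhase ε ℓ x))
  simp only [ContinuousLinearMap.coe_coe] at h
  rw [h]
  simp [Fintype.sum_sum_type, coe_rotatedBasis, twistLift, hb, norm_smul, mul_pow]

theorem contDiffOn_rotated_twistPhase (κ : ι ⊕ (K ⊕ K)) (U : Set E) :
    ContDiffOn ℝ ∞ (fun x => rotated b (twistPhase ε ℓ x) κ) U := by
  have hθ : ∀ k, ContDiff ℝ ∞ fun x => twistPhase ε ℓ x k := fun k =>
    contDiff_const.mul (contDiff_const.inner ℝ contDiff_id)
  rcases κ with j | k | k
  · exact contDiffOn_const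
  · exact (((hθ k).cos.smul contDiff_const).add ((hθ k).sin.smul contDiff_const)).contDiffOn
  · exact (((hθ k).sin.neg.smul contDiff_const).add
      ((hθ k).cos.smul contDiff_const)).contDiffOn

theorem contDiffOn_twistMap {U : Set E} (ha : ∀ k, ContDiffOn ℝ ∞ (a k) U) :
    ContDiffOn ℝ ∞ (twistMap b e ε a s ℓ) U := by
  refine ContDiffOn.add (ContDiffOn.sum fun j _ => ?_) (ContDiffOn.sum fun k _ => ?_)
  · exact (contDiff_const.mul (contDiff_const.inner ℝ contDiff_id)).contDiffOn.smul
      (contDiffOn_rotated_twistPhase _ U)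
  · exact (contDiffOn_const.mul (contDiffOn_const.mul (ha k))).smul
      (contDiffOn_rotated_twistPhase _ U)

theorem contDiffOn_twistLift {U : Set E} (ha : ∀ k, ContDiffOn ℝ ∞ (a k) U)
    {A : E → E →L[ℝ] F} (hA : ContDiffOn ℝ ∞ A U) :
    ContDiffOn ℝ ∞ (fun x => twistLift b ε a s ℓ (A x) x) U := by
  refine ContDiffOn.sum fun k _ => (contDiffOn_const.mul (ha k)).smul ?_
  exact ((innerSL ℝ).contDiff.comp_contDiffOn (contDiffOn_rotated_twistPhase _ U)).smulRight
    (hA.clm_apply contDiffOn_const)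

theorem contDiffOn_twistDecoder {U : Set E} (hU : IsOpen U) (ha : ∀ k, ContDiffOn ℝ ∞ (a k) U)
    {f : E → F} (hf : ContDiffOn ℝ ∞ f U) :
    ContDiffOn ℝ ∞ (twistDecoder b e ε a s ℓ f) (twistProj b e ε ⁻¹' U) := by
  have hp : ContDiffOn ℝ ∞ (twistProj b e ε) (twistProj b e ε ⁻¹' U) :=
    (twistProj b e ε).contDiff.contDiffOn
  have hm : Set.MapsTo (twistProj b e ε) (twistProj b e ε ⁻¹' U) U := fun _ h => h
  have hL := (contDiffOn_twistLift (b := b) (ε := ε) (s := s) (ℓ := ℓ) ha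
    (hf.fderiv_of_isOpen hU (m := ∞) (by simp))).comp hp hm
  exact (hf.comp hp hm).add
    (hL.clm_apply (contDiffOn_id.sub ((contDiffOn_twistMap ha).comp hp hm)))

/-- On the image of the encoder, the derivative of the decoder is its linear part: the derivative of
the lift is applied to the vector `0`, and the two contributions of the derivative of `twistProj`
cancel by `twistLift_comp_twistDeriv`. -/
theorem hasFDerivAt_twistDecoder (hε : ε ≠ 0) (hs : ∀ k, s k ≠ 0) {U : Set E} (hU : IsOpen U)
    (ha : ∀ k, ContDiffOn ℝ ∞ (a k) U) {f : E → F} (hf : ContDiffOn ℝ ∞ f U) {x : E} (hx : x ∈ U)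
    (hℓ : ∀ v, ∑ k, (a k x ^ 2 * ⟪ℓ k, v⟫) • ℓ k = v) :
    HasFDerivAt (twistDecoder b e ε a s ℓ f) (twistLift b ε a s ℓ (fderiv ℝ f x) x)
      (twistMap b e ε a s ℓ x) := by
  have hxU : U ∈ nhds x := hU.mem_nhds hx
  have hpx := twistProj_twistMap (b := b) (e := e) (a := a) (s := s) (ℓ := ℓ) hε x
  have hp : HasFDerivAt (twistProj b e ε) (twistProj b e ε) (twistMap b e ε a s ℓ x) :=
    (twistProj b e ε).hasFDerivAt
  have hf' : HasFDerivAt f (fderiv ℝ f x) (twistProj b e ε (twistMap b e ε a s ℓ x)) := by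
    rw [hpx]
    exact ((hf.contDiffAt hxU).differentiableAt (by simp)).hasFDerivAt
  have hh : HasFDerivAt (twistMap b e ε a s ℓ)
      (twistDeriv b e ε a s ℓ (fun k => fderiv ℝ (a k) x) x)
      (twistProj b e ε (twistMap b e ε a s ℓ x)) := by
    rw [hpx]
    exact hasFDerivAt_twistMap hε fun k =>
      (((ha k).contDiffAt hxU).differentiableAt (by simp)).hasFDerivAt
  have hL : HasFDerivAt (fun x => twistLift b ε a s ℓ (fderiv ℝ f x) x)
      (fderiv ℝ (fun x => twistLift b ε a s ℓ (fderiv ℝ f x) x) x)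
      (twistProj b e ε (twistMap b e ε a s ℓ x)) := by
    rw [hpx]
    exact (((contDiffOn_twistLift ha (hf.fderiv_of_isOpen hU (m := ∞) (by simp))).contDiffAt
      hxU).differentiableAt (by simp)).hasFDerivAt
  have h := (hf'.comp _ hp).add ((hL.comp _ hp).clm_apply ((hasFDerivAt_id _).sub (hh.comp _ hp)))
  refine h.congr_fderiv ?_
  have hc := twistLift_comp_twistDeriv (b := b) (e := e) (ε := ε) hs (fderiv ℝ f x) hℓ
    (fun k => fderiv ℝ (a k) x)
  ext w
  have hw := DFunLike.congr_fun hc (twistProj b e ε w)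
  simp only [ContinuousLinearMap.comp_apply] at hw
  simp [hpx, hw]

end NashTwist

/-! ### Jacobian matrices -/

section Jacobian

variable {n m : ℕ}

theorem toEuclideanLin_jacobian (f : EuclideanSpace ℝ (Fin n) → EuclideanSpace ℝ (Fin m))
    (x : EuclideanSpace ℝ (Fin n)) :
    Matrix.toEuclideanLin (jacobian f x) =
      (fderiv ℝ f x : EuclideanSpace ℝ (Fin n) →ₗ[ℝ] EuclideanSpace ℝ (Fin m)) := by
  refine (EuclideanSpace.basisFun (Fin n) ℝ).toBasis.ext fun j => ?_
  ext i
  simp [jacobian, Matrix.toLpLin_apply]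

theorem nuclearNorm_jacobian (f : EuclideanSpace ℝ (Fin n) → EuclideanSpace ℝ (Fin m))
    (x : EuclideanSpace ℝ (Fin n)) :
    nuclearNorm (jacobian f x) = ∑ i : Fin n,
      (fderiv ℝ f x : EuclideanSpace ℝ (Fin n) →ₗ[ℝ] EuclideanSpace ℝ (Fin m)).singularValues i := by
  rw [nuclearNorm, toEuclideanLin_jacobian, Finset.sum_range]

theorem frobeniusSq_jacobian (f : EuclideanSpace ℝ (Fin n) → EuclideanSpace ℝ (Fin m))
    (x : EuclideanSpace ℝ (Fin n)) :
    frobeniusSq (jacobian f x) = ∑ j, ‖fderiv ℝ f x (EuclideanSpace.basisFun (Fin n) ℝ j)‖ ^ 2 := by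
  simp [frobeniusSq, jacobian, EuclideanSpace.norm_sq_eq, Finset.sum_comm (γ := Fin m)]

variable {f : EuclideanSpace ℝ (Fin n) → EuclideanSpace ℝ (Fin m)}
  {Ω : Set (EuclideanSpace ℝ (Fin n))}

theorem SmoothOn.contDiffAt (hf : SmoothOn f Ω) {x : EuclideanSpace ℝ (Fin n)} (hx : x ∈ Ω) :
    ContDiffAt ℝ ∞ f x := by
  obtain ⟨U, hU, hΩU, hf⟩ := hf
  exact hf.contDiffAt (hU.mem_nhds (hΩU hx))

theorem SmoothOn.continuousOn (hf : SmoothOn f Ω) : ContinuousOn f Ω :=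
  fun _ hx => (hf.contDiffAt hx).continuousAt.continuousWithinAt

theorem SmoothOn.continuousOn_fderiv (hf : SmoothOn f Ω) : ContinuousOn (fderiv ℝ f) Ω :=
  fun _ hx => ((hf.contDiffAt hx).fderiv_right (m := 0) (by simp)).continuousAt.continuousWithinAt

theorem SmoothOn.comp {d : ℕ} {g : EuclideanSpace ℝ (Fin m) → EuclideanSpace ℝ (Fin d)}
    (hg : SmoothOn g (f '' Ω)) (hf : SmoothOn f Ω) : SmoothOn (g ∘ f) Ω := by
  obtain ⟨U, hU, hΩU, hf⟩ := hf
  obtain ⟨V, hV, hΩV, hg⟩ := hg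
  exact ⟨U ∩ f ⁻¹' V, hf.continuousOn.isOpen_inter_preimage hU hV,
    fun x hx => ⟨hΩU hx, hΩV ⟨x, hx, rfl⟩⟩,
    hg.comp (hf.mono Set.inter_subset_left) fun x hx => hx.2⟩

theorem SmoothOn.continuousOn_nuclearNorm (hf : SmoothOn f Ω) :
    ContinuousOn (fun x => nuclearNorm (jacobian f x)) Ω := by
  simp only [nuclearNorm_jacobian]
  exact (continuous_sum_singularValues (EuclideanSpace.basisFun (Fin n) ℝ)).comp_continuousOn
    hf.continuousOn_fderiv

theorem SmoothOn.continuousOn_frobeniusSq (hf : SmoothOn f Ω) :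
    ContinuousOn (fun x => frobeniusSq (jacobian f x)) Ω := by
  simp only [frobeniusSq_jacobian]
  exact continuousOn_finsetSum _ fun i _ =>
    ((hf.continuousOn_fderiv.clm_apply continuousOn_const).norm.pow 2)

/-- The pointwise inequality behind the easy half of the equality. -/
theorem two_mul_nuclearNorm_jacobian_comp_le {d : ℕ}
    {g : EuclideanSpace ℝ (Fin m) → EuclideanSpace ℝ (Fin d)} (hg : SmoothOn g (f '' Ω))
    (hf : SmoothOn f Ω) {x : EuclideanSpace ℝ (Fin n)} (hx : x ∈ Ω) :
    2 * nuclearNorm (jacobian (g ∘ f) x) ≤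
      frobeniusSq (jacobian g (f x)) + frobeniusSq (jacobian f x) := by
  rw [nuclearNorm_jacobian, frobeniusSq_jacobian, frobeniusSq_jacobian, fderiv_comp x
    ((hg.contDiffAt ⟨x, hx, rfl⟩).differentiableAt (by simp))
    ((hf.contDiffAt hx).differentiableAt (by simp))]
  exact two_mul_sum_singularValues_comp_le (fderiv ℝ g (f x)).toLinearMap
    (fderiv ℝ f x).toLinearMap (EuclideanSpace.basisFun (Fin n) ℝ)
    (EuclideanSpace.basisFun (Fin m) ℝ)

end Jacobian

/-! ### Factorization of a smooth map -/

/-- A smooth partition of unity by squares: the members of the partition are squares of smooth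
functions, as the amplitudes of the Nash twists have to be smooth. -/
theorem exists_sq_partition {E : Type*} [NormedAddCommGroup E] [InnerProductSpace ℝ E]
    [FiniteDimensional ℝ E] {Ω : Set E} (hΩ : IsCompact Ω) {N : E → Set E}
    (hN : ∀ x ∈ Ω, N x ∈ nhds x) :
    ∃ (t : Finset E) (ψ : t → E → ℝ) (U : Set E), IsOpen U ∧ Ω ⊆ U ∧
      (∀ i, ContDiffOn ℝ ∞ (ψ i) U) ∧ (∀ x ∈ U, ∑ i, ψ i x ^ 2 = 1) ∧
      ∀ i x, ψ i x ≠ 0 → x ∈ N i := by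
  have hr : ∀ x ∈ Ω, ∃ r > 0, Metric.ball x r ⊆ N x := fun x hx => Metric.mem_nhds_iff.mp (hN x hx)
  choose! r hr hrN using hr
  obtain ⟨t, htΩ, ht⟩ := hΩ.elim_nhds_subcover (fun x => Metric.ball x (r x / 2))
    fun x hx => Metric.ball_mem_nhds x (half_pos (hr x hx))
  let φ : ∀ i : t, ContDiffBump (i : E) := fun i =>
    ⟨r i / 2, r i, half_pos (hr i (htΩ i i.2)), half_lt_self (hr i (htΩ i i.2))⟩
  let S : E → ℝ := fun x => ∑ i, φ i x ^ 2
  have hφ : ∀ i, ContDiff ℝ ∞ (φ i) := fun i => (φ i).contDiff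
  have hS : ContDiff ℝ ∞ S := ContDiff.sum fun i _ => (hφ i).pow 2
  refine ⟨t, fun i x => φ i x / √(S x), {x | 0 < S x}, isOpen_lt continuous_const hS.continuous,
    fun x hx => ?_, fun i => ?_, fun x hx => ?_, fun i x hx => ?_⟩
  · obtain ⟨i, hi, hxi⟩ := Set.mem_iUnion₂.mp (ht hx)
    have h1 : φ ⟨i, hi⟩ x = 1 := (φ ⟨i, hi⟩).one_of_mem_closedBall
      (Metric.ball_subset_closedBall hxi)
    have h2 : φ ⟨i, hi⟩ x ^ 2 ≤ S x := Finset.single_le_sum (f := fun i => φ i x ^ 2)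
      (fun _ _ => sq_nonneg _) (Finset.mem_univ _)
    rw [h1, one_pow] at h2
    exact one_pos.trans_le h2
  · exact (hφ i).contDiffOn.div (hS.contDiffOn.sqrt fun x hx => (Set.mem_ofPred.mp hx).ne')
      fun x hx => (Real.sqrt_pos.mpr hx).ne'
  · have hx : 0 < S x := hx
    simp only [div_pow, ← Finset.sum_div, Real.sq_sqrt hx.le]
    exact div_self hx.ne'
  · refine hrN i (htΩ i i.2) ?_
    have h1 : x ∈ Function.support (φ i) := fun h => hx (by simp [h])
    rwa [(φ i).support_eq] at h1

/-- A smooth map factors through some `ℝᵈ` in such a way that the bound of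
`two_mul_nuclearNorm_jacobian_comp_le` is attained up to `δ`, uniformly on a compact set. -/
theorem SmoothOn.exists_factorization {n m : ℕ}
    {f : EuclideanSpace ℝ (Fin n) → EuclideanSpace ℝ (Fin m)}
    {Ω : Set (EuclideanSpace ℝ (Fin n))} (hΩ : IsCompact Ω) (hf : SmoothOn f Ω) {δ : ℝ}
    (hδ : 0 < δ) :
    ∃ (d : ℕ) (h : EuclideanSpace ℝ (Fin n) → EuclideanSpace ℝ (Fin d))
      (g : EuclideanSpace ℝ (Fin d) → EuclideanSpace ℝ (Fin m)),
      SmoothOn h Ω ∧ SmoothOn g (h '' Ω) ∧ ∀ x ∈ Ω, g (h x) = f x ∧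
        frobeniusSq (jacobian g (h x)) + frobeniusSq (jacobian h x) ≤
          2 * nuclearNorm (jacobian f x) + δ := by
  set e := EuclideanSpace.basisFun (Fin n) ℝ
  set A := fderiv ℝ f
  have hδ' : 0 < δ / (2 * (n + 1)) := by positivity
  choose v s hs hvs using fun x => exists_weights e (A x).toLinearMap hδ'
  -- The weights chosen for `x` remain nearly optimal in a neighbourhood of `x`.
  obtain ⟨t, ψ, U, hU, hΩU, hψ, hψ1, hψN⟩ := exists_sq_partition hΩ
    (N := fun x => {y | ∑ i, (s x i ^ 2 + (s x i)⁻¹ ^ 2 * ‖A y (v x i)‖ ^ 2) <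
      2 * ∑ i : Fin n, (A y).toLinearMap.singularValues i + δ / 2}) fun x hx => by
    have hA : ContinuousAt A x := ((hf.contDiffAt hx).fderiv_right (m := 0) (by simp)).continuousAt
    refine ContinuousAt.eventually_lt
      (f := fun y => ∑ i, (s x i ^ 2 + (s x i)⁻¹ ^ 2 * ‖A y (v x i)‖ ^ 2))
      (g := fun y => 2 * ∑ i : Fin n, (A y).toLinearMap.singularValues i + δ / 2) ?_ ?_ ?_
    · exact tendsto_finsetSum _ fun i _ => continuousAt_const.add
        (continuousAt_const.mul ((hA.clm_apply continuousAt_const).norm.pow 2))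
    · exact (continuousAt_const.mul ((continuous_sum_singularValues e).continuousAt.comp hA)).add
        continuousAt_const
    · refine (hvs x).trans_lt (add_lt_add_right ?_ _)
      rw [mul_div_assoc', div_lt_div_iff₀ (by positivity) two_pos]
      nlinarith
  obtain ⟨U', hU', hΩU', hfU'⟩ := hf
  set W := U ∩ U'
  have hW : IsOpen W := hU.inter hU'
  have hΩW : Ω ⊆ W := Set.subset_inter hΩU hΩU'
  have hfW : ContDiffOn ℝ ∞ f W := hfU'.mono Set.inter_subset_right
  let a : t × Fin n → EuclideanSpace ℝ (Fin n) → ℝ := fun k => ψ k.1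
  let s' : t × Fin n → ℝ := fun k => s k.1 k.2
  let ℓ : t × Fin n → EuclideanSpace ℝ (Fin n) := fun k => v k.1 k.2
  have ha : ∀ k, ContDiffOn ℝ ∞ (a k) W := fun k => (hψ k.1).mono Set.inter_subset_left
  have hs' : ∀ k, s' k ≠ 0 := fun k => (hs k.1 k.2).ne'
  have hℓ : ∀ k, ‖ℓ k‖ = 1 := fun k => (v k.1).norm_eq_one k.2
  have hid : ∀ x ∈ W, ∀ w, ∑ k, (a k x ^ 2 * inner ℝ (ℓ k) w) • ℓ k = w := fun x hx w => by
    simp only [a, ℓ, Fintype.sum_prod_type, mul_smul, ← Finset.smul_sum, OrthonormalBasis.sum_repr',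
      ← Finset.sum_smul, hψ1 x hx.1, one_smul]
  obtain ⟨C, hC⟩ := hΩ.exists_bound_of_continuousOn (f := fun x => (Fintype.card (Fin n) : ℝ) +
    ∑ k, s' k ^ 2 * ∑ i, fderiv ℝ (a k) x (e i) ^ 2) <| by
    refine continuousOn_const.add (continuousOn_finsetSum _ fun k _ => continuousOn_const.mul
      (continuousOn_finsetSum _ fun i _ => ContinuousOn.pow ?_ 2))
    exact (((ha k).continuousOn_fderiv_of_isOpen hW (by simp)).mono hΩW).clm_apply
      continuousOn_const
  have hC0 : 0 < |C| + 1 := by positivity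
  set ε := √(δ / (2 * (|C| + 1)))
  have hε : 0 < ε := Real.sqrt_pos.mpr (by positivity)
  have hεC : ε ^ 2 * C ≤ δ / 2 := by
    rw [Real.sq_sqrt (by positivity), div_mul_eq_mul_div, div_le_div_iff₀ (by positivity) two_pos]
    nlinarith [le_abs_self C]
  let b := (EuclideanSpace.basisFun _ ℝ).reindex
    (Fintype.equivFin (Fin n ⊕ (t × Fin n) ⊕ (t × Fin n))).symm
  refine ⟨_, twistMap b e ε a s' ℓ, twistDecoder b e ε a s' ℓ f,
    ⟨W, hW, hΩW, contDiffOn_twistMap ha⟩, ⟨twistProj b e ε ⁻¹' W,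
      hW.preimage (twistProj b e ε).continuous, ?_, contDiffOn_twistDecoder hW ha hfW⟩,
    fun x hx => ⟨twistDecoder_twistMap hε.ne' f x, ?_⟩⟩
  · rintro _ ⟨x, hx, rfl⟩
    rw [Set.mem_preimage, twistProj_twistMap hε.ne']
    exact hΩW hx
  have hxW := hΩW hx
  rw [frobeniusSq_jacobian, frobeniusSq_jacobian, nuclearNorm_jacobian,
    (hasFDerivAt_twistDecoder hε.ne' hs' hW ha hfW hxW (hid x hxW)).fderiv,
    (hasFDerivAt_twistMap hε.ne' fun k =>
      (((ha k).contDiffAt (hW.mem_nhds hxW)).differentiableAt (by simp)).hasFDerivAt).fderiv,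
    sum_norm_sq_twistDeriv hℓ]
  have h0 := (sum_norm_sq_apply_eq (twistLift b ε a s' ℓ (A x) x).toLinearMap
    (EuclideanSpace.basisFun _ ℝ) b).trans (sum_norm_sq_twistLift (A x) x)
  simp only [ContinuousLinearMap.coe_coe] at h0
  rw [h0]
  have h1 : ε ^ 2 * ((Fintype.card (Fin n) : ℝ) +
      ∑ k, s' k ^ 2 * ∑ i, fderiv ℝ (a k) x (e i) ^ 2) ≤ δ / 2 :=
    (mul_le_mul_of_nonneg_left ((le_abs_self _).trans (hC x hx)) (sq_nonneg ε)).trans hεC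
  have h2 : ∑ k, (s' k)⁻¹ ^ 2 * a k x ^ 2 * ‖A x (ℓ k)‖ ^ 2 + ∑ k, s' k ^ 2 * a k x ^ 2 ≤
      2 * ∑ i : Fin n, (A x).toLinearMap.singularValues i + δ / 2 := by
    calc _ = ∑ i, ψ i x ^ 2 * ∑ j, (s i j ^ 2 + (s i j)⁻¹ ^ 2 * ‖A x (v i j)‖ ^ 2) := by
          rw [← Finset.sum_add_distrib, Fintype.sum_prod_type]
          simp only [Finset.mul_sum]
          exact Finset.sum_congr rfl fun i _ => Finset.sum_congr rfl fun j _ => by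
            simp only [a, s', ℓ]; ring
      _ ≤ ∑ i, ψ i x ^ 2 * (2 * ∑ i : Fin n, (A x).toLinearMap.singularValues i + δ / 2) := by
          refine Finset.sum_le_sum fun i _ => ?_
          by_cases h : ψ i x = 0
          · simp [h]
          · exact mul_le_mul_of_nonneg_left (hψN i x h).le (sq_nonneg _)
      _ = _ := by rw [← Finset.sum_mul, hψ1 x hxW.1, one_mul]
  linarith

/-! ### The two infima -/

theorem integrable_of_continuousOn {E : Type*} [TopologicalSpace E] [T2Space E] [MeasurableSpace E]
    [OpensMeasurableSpace E] {μ : Measure E} [IsFiniteMeasure μ] {Ω : Set E} (hΩ : IsCompact Ω)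
    (hsupp : μ Ωᶜ = 0) {F : E → ℝ} (hF : ContinuousOn F Ω) : Integrable F μ := by
  have h : μ.restrict Ω = μ := Measure.restrict_eq_self_of_ae_mem (mem_ae_iff.mpr hsupp)
  have := hF.integrableOn_compact hΩ (μ := μ)
  rwa [IntegrableOn, h] at this

/-- The expectations on both sides exist, and the two infima agree; they are taken in the extended
reals, so that an objective that is not bounded below has infimum `-∞`. -/
theorem theorem1 {n m : ℕ} (Ω : Set (EuclideanSpace ℝ (Fin n))) (hΩ : IsCompact Ω)
    (μ : Measure (EuclideanSpace ℝ (Fin n))) [IsProbabilityMeasure μ]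
    (hsupp : μ Ωᶜ = 0) (hac : μ ≪ (volume : Measure (EuclideanSpace ℝ (Fin n))).restrict Ω)
    (ℓ : EuclideanSpace ℝ (Fin m) × EuclideanSpace ℝ (Fin n) → ℝ) (hℓ : ContDiff ℝ 1 ℓ)
    (η : ℝ) (hη : 0 ≤ η) :
    (∀ f : EuclideanSpace ℝ (Fin n) → EuclideanSpace ℝ (Fin m), SmoothOn f Ω →
      Integrable (nuclearIntegrand ℓ η f) μ) ∧
    (∀ (d : ℕ) (h : EuclideanSpace ℝ (Fin n) → EuclideanSpace ℝ (Fin d))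
      (g : EuclideanSpace ℝ (Fin d) → EuclideanSpace ℝ (Fin m)),
      SmoothOn h Ω → SmoothOn g (h '' Ω) → Integrable (factoredIntegrand ℓ η g h) μ) ∧
    (⨅ (f : EuclideanSpace ℝ (Fin n) → EuclideanSpace ℝ (Fin m)) (_ : SmoothOn f Ω),
      ((∫ x, nuclearIntegrand ℓ η f x ∂μ : ℝ) : EReal)) =
    ⨅ (d : ℕ) (h : EuclideanSpace ℝ (Fin n) → EuclideanSpace ℝ (Fin d))
      (g : EuclideanSpace ℝ (Fin d) → EuclideanSpace ℝ (Fin m))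
      (_ : SmoothOn h Ω) (_ : SmoothOn g (h '' Ω)),
      ((∫ x, factoredIntegrand ℓ η g h x ∂μ : ℝ) : EReal) := by
  have hint1 : ∀ f : EuclideanSpace ℝ (Fin n) → EuclideanSpace ℝ (Fin m), SmoothOn f Ω →
      Integrable (nuclearIntegrand ℓ η f) μ := fun f hf =>
    integrable_of_continuousOn hΩ hsupp
      ((hℓ.continuous.comp_continuousOn (hf.continuousOn.prodMk continuousOn_id)).add
        (continuousOn_const.mul hf.continuousOn_nuclearNorm))
  have hint2 : ∀ (d : ℕ) (h : EuclideanSpace ℝ (Fin n) → EuclideanSpace ℝ (Fin d))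
      (g : EuclideanSpace ℝ (Fin d) → EuclideanSpace ℝ (Fin m)),
      SmoothOn h Ω → SmoothOn g (h '' Ω) → Integrable (factoredIntegrand ℓ η g h) μ :=
    fun d h g hh hg => by
      have hm : Set.MapsTo h Ω (h '' Ω) := Set.mapsTo_image h Ω
      exact integrable_of_continuousOn hΩ hsupp
        ((hℓ.continuous.comp_continuousOn
          ((hg.continuousOn.comp hh.continuousOn hm).prodMk continuousOn_id)).add
        (continuousOn_const.mul ((hg.continuousOn_frobeniusSq.comp hh.continuousOn hm).add
          hh.continuousOn_frobeniusSq)))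
  have hae : ∀ᵐ x ∂μ, x ∈ Ω := mem_ae_iff.mpr hsupp
  refine ⟨hint1, hint2, le_antisymm ?_ ?_⟩
  · refine le_iInf fun d => le_iInf fun h => le_iInf fun g => le_iInf fun hh => le_iInf fun hg => ?_
    refine iInf₂_le_of_le (g ∘ h) (hg.comp hh) (EReal.coe_le_coe_iff.mpr ?_)
    refine integral_mono_ae (hint1 _ (hg.comp hh)) (hint2 d h g hh hg) ?_
    filter_upwards [hae] with x hx
    have := mul_le_mul_of_nonneg_left (two_mul_nuclearNorm_jacobian_comp_le hg hh hx) hη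
    simp only [nuclearIntegrand, factoredIntegrand, Function.comp_apply]
    linarith
  · refine le_iInf₂ fun f hf => EReal.le_of_forall_lt_iff_le.mp fun c hc => ?_
    have hc' : ∫ x, nuclearIntegrand ℓ η f x ∂μ < c := EReal.coe_lt_coe_iff.mp hc
    -- The error `η / 2 * δ` in the integrand has to stay below the gap to `c`, also when `η = 0`.
    obtain ⟨d, h, g, hh, hg, hgh⟩ := hf.exists_factorization hΩ
      (δ := (c - ∫ x, nuclearIntegrand ℓ η f x ∂μ) / (η + 1))
      (div_pos (sub_pos.mpr hc') (by positivity))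
    refine iInf_le_of_le d <| iInf_le_of_le h <| iInf_le_of_le g <| iInf_le_of_le hh <|
      iInf_le_of_le hg <| EReal.coe_le_coe_iff.mpr ?_
    have hgap : η * ((c - ∫ x, nuclearIntegrand ℓ η f x ∂μ) / (η + 1)) ≤
        c - ∫ x, nuclearIntegrand ℓ η f x ∂μ := by
      rw [mul_div_assoc', div_le_iff₀ (by positivity)]
      nlinarith
    calc ∫ x, factoredIntegrand ℓ η g h x ∂μ
        ≤ ∫ x, (nuclearIntegrand ℓ η f x + (c - ∫ x, nuclearIntegrand ℓ η f x ∂μ)) ∂μ := by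
          refine integral_mono_ae (hint2 d h g hh hg) ((hint1 f hf).add (integrable_const _)) ?_
          filter_upwards [hae] with x hx
          obtain ⟨h1, h2⟩ := hgh x hx
          have := mul_le_mul_of_nonneg_left h2 hη
          rw [nuclearIntegrand, factoredIntegrand, h1]
          linarith
      _ = c := by
          rw [integral_add (hint1 f hf) (integrable_const _)]
          simp
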